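/- **Schmidt's game.** Let $(X,\lambda)$ be a complete metric space, $S\subseteq X$, $\alpha,\beta\in(0,1)$, $\rho>0$, and put $\rho_n=(\alpha\beta)^n\rho$. Bob chooses $x_0\in X$; then, for $n=1,2,\dots$, Alice chooses $y_n\in X$ with $\lambda(x_{n-1},y_n)+\alpha\rho_{n-1}\le\rho_{n-1}$ and Bob chooses $x_n\in X$ with $\lambda(y_n,x_n)+\rho_n\le\alpha\rho_{n-1}$. The outcome is the unique point that lies in all the closed balls with centre $x_n$ and radius $\rho_n$ ($n\ge 0$) and with centre $y_n$ and radius $\alpha\rho_{n-1}$ ($n\ge 1$). The set $S$ is $(\alpha,\beta,\rho)$-winning if Alice has a strategy that makes the outcome lie in $S$ however Bob plays; it is $(\alpha,\beta)$-winning if it is $(\alpha,\beta,\rho)$-winning for every $\rho>0$, and $\alpha$-winning if it is $(\alpha,\beta)$-winning for every $\beta\in(0,1)$. Below, $X=[0,1]$ with the usual distance. **Expansions.** Let $b>1$ be real and $T(x)=bx-\lfloor bx\rfloor$. The $b$-expansion of $x\in[0,1)$ is the digit sequence $\mathbf d(x)=d_1d_2\cdots$ with $d_j=\lfloor b\,T^{j-1}(x)\rfloor$.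 The quasi-greedy expansion of $1$ is the digitwise limit $\lim_{\varepsilon\to0^+}\mathbf d(1-\varepsilon)$; let $d'$ be its minimal digit. Let $i_b\in\{0,1,2,\dots\}\cup\{\infty\}$ be the position of the last nonzero digit of the $b$-expansion of $b-\lfloor b\rfloor$ ($i_b=0$ if all its digits are zero, $i_b=\infty$ if infinitely many are nonzero), and let $K_b\in\{0,1,2,\dots\}\cup\{\infty\}$ be the supremum of the lengths of the blocks of consecutive zeros among its first $i_b$ digits. **Theorem.** Let $b>1$ be real with $K=K_b<\infty$, let $d$ be an integer with $0\le d\le d'$, and let $$C_b[d]=\{x\in[0,1): d \text{ appears in } \mathbf d(x)\},$$ regarded as a subset of $X=[0,1]$. (a) Let $\alpha,\beta\in(0,1)$ be such that $\log_b(\alpha\beta)\notin\mathbb Q$ and $$\beta>A_b(\alpha):=\frac{(2(Kb+2b)+1)\alpha-1}{\alpha\,[(4(Kb+2b)-1)-\alpha(2(Kb+2b)-1)]}.$$ Then $C_b[d]$ is $(\alpha,\beta)$-winning. (b) If $\alpha\in(0,1)$ and $\alpha<\dfrac{1}{2Kb^2+4b^2+1}$, then $C_b[d]$ is $\alpha$-winning.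 -/

import Mathlib

open Filter Topology

noncomputable section

/-! ## Schmidt's game -/

/-- Alice has a strategy to win the `(α, β, ρ)`-game with target set `S` on `X`.
Bob's centres are `x 0, x 1, …` (ball `n` has radius `(αβ)ⁿ ρ`); the strategy `σ` answers the
centres `x 0, …, x n` with the centre `σ n _` of Alice's next ball, of radius `α (αβ)ⁿ ρ`.
Against every legal play of Bob, Alice's answers have to be legal and the outcome (the point common
to all balls, unique since the radii tend to `0`) has to lie in `S`.
A finite legal play of Bob always extends to an infinite one (he may repeat Alice's centre), so
that the strategy is legal after every finite legal play, too. -/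
def SchmidtWinningFrom {X : Type*} [MetricSpace X] (α β ρ : ℝ) (S : Set X) : Prop :=
  ∃ σ : (n : ℕ) → (Fin (n + 1) → X) → X,
    ∀ x y : ℕ → X, (∀ n, y n = σ n (fun i => x i)) →
      (∀ n, dist (y n) (x (n + 1)) + (α * β) ^ (n + 1) * ρ ≤ α * ((α * β) ^ n * ρ)) →
        (∀ n, dist (x n) (y n) + α * ((α * β) ^ n * ρ) ≤ (α * β) ^ n * ρ) ∧
          ∃ ω ∈ S, ∀ n, ω ∈ Metric.closedBall (x n) ((α * β) ^ n * ρ) ∧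
            ω ∈ Metric.closedBall (y n) (α * ((α * β) ^ n * ρ))

/-- `S` is `(α, β)`-winning: `(α, β, ρ)`-winning for every initial radius `ρ > 0`. -/
def SchmidtWinning {X : Type*} [MetricSpace X] (α β : ℝ) (S : Set X) : Prop :=
  ∀ ρ : ℝ, 0 < ρ → SchmidtWinningFrom α β ρ S

/-- `S` is `α`-winning: `(α, β)`-winning for every `β ∈ (0, 1)`. -/
def SchmidtAlphaWinning {X : Type*} [MetricSpace X] (α : ℝ) (S : Set X) : Prop :=
  ∀ β : ℝ, 0 < β → β < 1 → SchmidtWinning α β S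

/-! ## Expansions in a real base -/

/-- The transformation `x ↦ b x - ⌊b x⌋`. -/
def betaMap (b x : ℝ) : ℝ := Int.fract (b * x)

/-- The `b`-expansion of `x ∈ [0, 1)`; entry `j` is the digit with weight `b ^ (-(j + 1))`. -/
def bExpansion (b x : ℝ) : ℕ → ℕ := fun j => ⌊b * (betaMap b)^[j] x⌋₊

lemma iterate_betaMap_mem (b : ℝ) {x : ℝ} (hx : x ∈ Set.Ico (0 : ℝ) 1) (n : ℕ) :
    (betaMap b)^[n] x ∈ Set.Ico (0 : ℝ) 1 := by
  cases n with
  | zero => simpa using hx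
  | succ n =>
    rw [Function.iterate_succ_apply']
    exact ⟨Int.fract_nonneg _, Int.fract_lt_one _⟩

/-- The digits are those for which all the rescaled remainders lie in `[0, 1)`. -/
theorem bExpansion_spec {b : ℝ} (hb : 1 < b) {x : ℝ} (hx : x ∈ Set.Ico (0 : ℝ) 1) (n : ℕ) :
    b ^ n * (x - ∑ k ∈ Finset.range n, (bExpansion b x k : ℝ) / b ^ (k + 1)) ∈
      Set.Ico (0 : ℝ) 1 := by
  have hb0 : (0 : ℝ) < b := by linarith
  have key : b ^ n * (x - ∑ k ∈ Finset.range n, (bExpansion b x k : ℝ) / b ^ (k + 1)) =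
      (betaMap b)^[n] x := by
    induction n with
    | zero => simp
    | succ n ih =>
      have h0 : 0 ≤ b * (betaMap b)^[n] x := mul_nonneg hb0.le (iterate_betaMap_mem b hx n).1
      have hf : ((bExpansion b x n : ℕ) : ℝ) = (⌊b * (betaMap b)^[n] x⌋ : ℝ) := by
        rw [bExpansion]; exact natCast_floor_eq_intCast_floor h0
      rw [Function.iterate_succ_apply', betaMap, Int.fract, ← hf, ← ih, Finset.sum_range_succ]
      field_simp
      ring
  rw [key]
  exact iterate_betaMap_mem b hx n

/-- `C_b[d]`: the points of `[0, 1)` whose `b`-expansion contains the digit `d`. -/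
def digitSet (b : ℝ) (d : ℕ) : Set ℝ := {x | x ∈ Set.Ico (0 : ℝ) 1 ∧ ∃ j, bExpansion b x j = d}

/-- The quasi-greedy expansion of `1`: the digitwise limit of the `b`-expansion of `x` as `x` tends
to `1` from the left (`ℕ → ℕ` carries the product of the discrete topologies). -/
def quasiGreedy (b : ℝ) : ℕ → ℕ := limUnder (𝓝[<] (1 : ℝ)) (bExpansion b)

lemma exists_tendsto_iterate_betaMap {b : ℝ} (hb : 1 < b) (j : ℕ) :
    ∃ t : ℝ, 0 < t ∧ Tendsto (fun x => (betaMap b)^[j] x) (𝓝[<] (1 : ℝ)) (𝓝[<] t) ∧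
      ∃ c : ℕ, ∀ᶠ x in 𝓝[<] (1 : ℝ), bExpansion b x j = c := by
  have hb0 : (0 : ℝ) < b := by linarith
  have step : ∀ t : ℝ, 0 < t → ∃ n : ℕ, (n : ℝ) < b * t ∧
      ∀ᶠ y in 𝓝[<] t, (n : ℝ) < b * y ∧ b * y < n + 1 ∧ b * y < b * t := by
    intro t ht
    have hbt : 0 < b * t := mul_pos hb0 ht
    obtain ⟨n, hn⟩ : ∃ n : ℕ, ⌈b * t⌉₊ = n + 1 :=
      Nat.exists_eq_succ_of_ne_zero (Nat.ceil_pos.2 hbt).ne'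
    have h1 : (n : ℝ) < b * t := Nat.lt_ceil.1 (by omega)
    have h2 : b * t ≤ n + 1 := by
      have := Nat.le_ceil (b * t)
      rw [hn] at this
      exact_mod_cast this
    refine ⟨n, h1, ?_⟩
    have hc : Tendsto (fun y : ℝ => b * y) (𝓝[<] t) (𝓝 (b * t)) :=
      ((continuous_const.mul continuous_id).tendsto t).mono_left nhdsWithin_le_nhds
    filter_upwards [hc.eventually (lt_mem_nhds h1), self_mem_nhdsWithin] with y hy hyt
    have : b * y < b * t := mul_lt_mul_of_pos_left hyt hb0
    exact ⟨hy, by linarith, this⟩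
  have digit : ∀ t : ℝ, 0 < t →
      Tendsto (fun x => (betaMap b)^[j] x) (𝓝[<] (1 : ℝ)) (𝓝[<] t) →
        ∃ c : ℕ, ∀ᶠ x in 𝓝[<] (1 : ℝ), bExpansion b x j = c := by
    intro t ht h
    obtain ⟨n, -, hn⟩ := step t ht
    refine ⟨n, ?_⟩
    filter_upwards [h.eventually hn] with x hx
    exact (Nat.floor_eq_iff (le_trans n.cast_nonneg hx.1.le)).2 ⟨hx.1.le, hx.2.1⟩
  have main : ∃ t : ℝ, 0 < t ∧
      Tendsto (fun x => (betaMap b)^[j] x) (𝓝[<] (1 : ℝ)) (𝓝[<] t) := by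
    clear digit
    induction j with
    | zero => exact ⟨1, one_pos, tendsto_id⟩
    | succ j ih =>
      obtain ⟨t, ht, h⟩ := ih
      obtain ⟨n, hnt, hn⟩ := step t ht
      refine ⟨b * t - n, by linarith, ?_⟩
      have hstep : Tendsto (betaMap b) (𝓝[<] t) (𝓝[<] (b * t - n)) := by
        have hfr : ∀ᶠ y in 𝓝[<] t, b * y - n = betaMap b y := by
          filter_upwards [hn] with y hy
          refine (Int.fract_eq_iff.2 ⟨by linarith [hy.1], by linarith [hy.2.1], n, ?_⟩).symm
          push_cast
          ring
        refine Tendsto.congr' hfr (tendsto_nhdsWithin_iff.2 ⟨?_, ?_⟩)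
        · exact (((continuous_const.mul continuous_id).sub continuous_const).tendsto t).mono_left
            nhdsWithin_le_nhds
        · filter_upwards [hn] with y hy
          exact sub_lt_sub_right hy.2.2 _
      simp only [Function.iterate_succ_apply']
      exact hstep.comp h
  obtain ⟨t, ht, h⟩ := main
  exact ⟨t, ht, h, digit t ht h⟩

/-- The limit that defines `quasiGreedy` exists. -/
theorem tendsto_quasiGreedy {b : ℝ} (hb : 1 < b) :
    Tendsto (bExpansion b) (𝓝[<] (1 : ℝ)) (𝓝 (quasiGreedy b)) := by
  choose t _ _ c hc using fun j => exists_tendsto_iterate_betaMap hb j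
  refine tendsto_nhds_limUnder ⟨c, tendsto_pi_nhds.2 fun j => ?_⟩
  exact tendsto_const_nhds.congr' ((hc j).mono fun x hx => hx.symm)

/-- The minimal digit of the quasi-greedy expansion of `1`. -/
def minQuasiGreedyDigit (b : ℝ) : ℕ := sInf (Set.range (quasiGreedy b))

/-- The length of the `b`-expansion of `b - ⌊b⌋`: the position (counted from one) of its last
nonzero digit, `0` if all digits vanish and `⊤` if infinitely many do not. -/
def fractLength (b : ℝ) : ℕ∞ :=
  ⨆ (j : ℕ) (_ : bExpansion b (Int.fract b) j ≠ 0), ((j + 1 : ℕ) : ℕ∞)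

/-- `K_b`: the supremum of the lengths `L` of the blocks of zeros (at the positions
`s, …, s + L - 1`, counted from zero) among the first `fractLength b` digits of the `b`-expansion
of `b - ⌊b⌋`. -/
def maxZeroRun (b : ℝ) : ℕ∞ :=
  ⨆ (s : ℕ) (L : ℕ) (_ : ((s + L : ℕ) : ℕ∞) ≤ fractLength b ∧
    ∀ j < L, bExpansion b (Int.fract b) (s + j) = 0), (L : ℕ∞)

/-- The rational function `A_b`, with `K` in the role of `K_b`. -/
def winningBound (b K α : ℝ) : ℝ :=
  ((2 * (K * b + 2 * b) + 1) * α - 1) /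
    (α * ((4 * (K * b + 2 * b) - 1) - α * (2 * (K * b + 2 * b) - 1)))

end

/-! Let `r = (αβ)^N ρ` be Bob's radius at a late stage `N`. Alice moves to the midpoint `z` of an
interval of length `δ = b^m` inside `C_b[d]` and from then on returns towards `z` as far as the
rules allow. If Bob's radius is `s`, he can push her away by `α(1-β)s` and she can then come back by
`(1-α)αβs`, so her distance from `z` grows by at most `α(1-2β+αβ)s`. Summing the geometric series,
the outcome stays in the interval if `2α(1-2β+αβ)/(1-αβ) < δ/r`. She can reach `z` if `δ/r ≤
(1-α)/L`, where `L = Kb+2b` (`exists_closedBall_subset_digitSet`).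

The constant `L` comes from full cylinders, which contain a whole interval of digit `d`. The digits
of a cylinder that is not full end in a prefix of the expansion of 1. Its left neighbour lowers the
last nonzero digit of that prefix and then ends in a prefix at most as long as the block of zeros it
replaces. So one step to the left brings the index to at most `K`, and every further step lowers it
(`IsCylinder.exists_full`).

It remains to put `b^m / r` into the window. If `log_b(αβ)` is irrational, this is possible by
density for every window of positive length, and the length is positive exactly when `β > A_b(α)`.
In (b) the window contains `[2α, 2αb]`, which meets every set of the form `{b^m / r}`. -/

/-! ## A sufficient condition for winning -/

/-- Alice wins if at some stage `N` every point of `X` has within Alice's reach the centre of a ball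
of radius `h` in the target set, where `h` bounds how far Bob can move away from this centre. -/
theorem schmidtWinningFrom_of_forall_exists_closedBall_subset {X : Type*} [MetricSpace X]
    [CompleteSpace X]
    (hX : ∀ (x z : X) (R : ℝ), 0 ≤ R → ∃ y, dist x y ≤ R ∧ dist y z ≤ max 0 (dist x z - R))
    {α β ρ h : ℝ} (hα0 : 0 < α) (hα1 : α < 1) (hβ0 : 0 < β) (hβ1 : β < 1) (hρ : 0 < ρ) {S : Set X}
    (N : ℕ) (h0 : 0 ≤ h)
    (hh : α * ((α * β) ^ N * ρ) * (1 - 2 * β + α * β) ≤ h * (1 - α * β))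
    (hS : ∀ x : X, ∃ z, dist x z ≤ (1 - α) * ((α * β) ^ N * ρ) ∧ Metric.closedBall z h ⊆ S) :
    SchmidtWinningFrom α β ρ S := by
  have hq0 : 0 < α * β := mul_pos hα0 hβ0
  have hq1 : α * β < 1 := by nlinarith
  have hr : ∀ n, 0 < (α * β) ^ n * ρ := fun n => mul_pos (pow_pos hq0 n) hρ
  -- With `0 ≤ R` moved behind the existential, `choose` yields a function `move` of `x`, `z`, `R`
  -- alone.
  have hX' : ∀ (x z : X) (R : ℝ), ∃ y, 0 ≤ R → dist x y ≤ R ∧ dist y z ≤ max 0 (dist x z - R) := by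
    intro x z R
    by_cases hR : 0 ≤ R
    · obtain ⟨y, hy⟩ := hX x z R hR
      exact ⟨y, fun _ => hy⟩
    · exact ⟨x, fun h => absurd h hR⟩
  choose move hmove using hX'
  choose Z hZ hZS using hS
  refine ⟨fun n p => if hn : N ≤ n then
    move (p (Fin.last n)) (Z (p ⟨N, by omega⟩)) ((1 - α) * ((α * β) ^ n * ρ))
    else p (Fin.last n), ?_⟩
  intro x y hy hx
  have hR : ∀ n, 0 ≤ (1 - α) * ((α * β) ^ n * ρ) :=
    fun n => mul_nonneg (by linarith) (hr n).le
  have hyN : ∀ n, N ≤ n → y n = move (x n) (Z (x N)) ((1 - α) * ((α * β) ^ n * ρ)) := by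
    intro n hn
    rw [hy n]
    simp [hn]
  have hlegal : ∀ n, dist (x n) (y n) + α * ((α * β) ^ n * ρ) ≤ (α * β) ^ n * ρ := by
    intro n
    by_cases hn : N ≤ n
    · have := (hmove (x n) (Z (x N)) _ (hR n)).1
      rw [← hyN n hn] at this
      linarith
    · have : y n = x n := by
        rw [hy n]
        simp [hn]
      rw [this, dist_self]
      linarith [hR n]
  refine ⟨hlegal, ?_⟩
  have hstep : ∀ n, dist (x n) (x (n + 1)) ≤ (α * β) ^ n * ρ - (α * β) ^ (n + 1) * ρ := by
    intro n
    linarith [dist_triangle (x n) (y n) (x (n + 1)), hlegal n, hx n]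
  have hanti : ∀ n k, dist (x n) (x (n + k)) ≤ (α * β) ^ n * ρ - (α * β) ^ (n + k) * ρ := by
    intro n k
    induction k with
    | zero => simp
    | succ k ih =>
      have h1 := dist_triangle (x n) (x (n + k)) (x (n + k + 1))
      have h2 := hstep (n + k)
      rw [← add_assoc]
      linarith
  have hr_lim : Tendsto (fun n => (α * β) ^ n * ρ) atTop (𝓝 0) := by
    simpa using (tendsto_pow_atTop_nhds_zero_of_lt_one hq0.le hq1).mul_const ρ
  have hcauchy : CauchySeq x := by
    refine cauchySeq_of_le_tendsto_0' (fun n => (α * β) ^ n * ρ) (fun n m hnm => ?_) hr_lim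
    obtain ⟨k, rfl⟩ := Nat.exists_eq_add_of_le hnm
    linarith [hanti n k, hr (n + k)]
  obtain ⟨ω, hω⟩ := cauchySeq_tendsto_of_complete hcauchy
  have hωx : ∀ n, dist (x n) ω ≤ (α * β) ^ n * ρ := by
    intro n
    refine le_of_tendsto (tendsto_const_nhds.dist hω) ?_
    filter_upwards [eventually_ge_atTop n] with m hm
    obtain ⟨k, rfl⟩ := Nat.exists_eq_add_of_le hm
    linarith [hanti n k, hr (n + k)]
  have hωy : ∀ n, dist (y n) ω ≤ α * ((α * β) ^ n * ρ) := by
    intro n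
    linarith [dist_triangle (y n) (x (n + 1)) ω, hx n, hωx (n + 1)]
  refine ⟨ω, hZS (x N) ?_, fun n => ⟨?_, ?_⟩⟩
  -- By `hh`, the drift in round `k` is at most `h (1 - αβ) (αβ)^k`; these bounds telescope.
  · have key : ∀ k, dist (y (N + k)) (Z (x N)) ≤ h * (1 - (α * β) ^ k) := by
      intro k
      induction k with
      | zero =>
        have h1 := (hmove (x N) (Z (x N)) _ (hR N)).2
        rw [← hyN N le_rfl, max_eq_left (by linarith [hZ (x N)])] at h1
        simpa using h1
      | succ k ih =>
        have h1 := (hmove (x (N + (k + 1))) (Z (x N)) _ (hR (N + (k + 1)))).2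
        rw [← hyN _ (by omega)] at h1
        refine h1.trans (max_le ?_ ?_)
        · exact mul_nonneg h0 (by linarith [pow_le_one₀ hq0.le hq1.le (n := k + 1)])
        · have h2 := dist_triangle (x (N + (k + 1))) (y (N + k)) (Z (x N))
          have h3 := hx (N + k)
          rw [dist_comm] at h3
          rw [← add_assoc] at h2 ⊢
          have h4 := mul_le_mul_of_nonneg_left hh (pow_pos hq0 k).le
          have e1 : (α * β) ^ (N + k + 1) * ρ = (α * β) * ((α * β) ^ k * ((α * β) ^ N * ρ)) := by
            ring
          have e2 : (α * β) ^ (N + k) * ρ = (α * β) ^ k * ((α * β) ^ N * ρ) := by ring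
          have e3 : (α * β) ^ (k + 1) = (α * β) * (α * β) ^ k := by ring
          rw [e1, e2] at h3
          rw [e1, e3]
          linarith
    rw [Metric.mem_closedBall]
    have hlim : Tendsto (fun k => α * ((α * β) ^ (N + k) * ρ) + h) atTop (𝓝 h) := by
      have := ((hr_lim.comp (tendsto_add_atTop_nat N)).const_mul α).add_const h
      simpa [Function.comp_def, add_comm] using this
    refine ge_of_tendsto' hlim fun k => ?_
    have h1 := dist_triangle ω (y (N + k)) (Z (x N))
    have h2 := hωy (N + k)
    rw [dist_comm] at h2
    have h3 : 0 ≤ h * (α * β) ^ k := mul_nonneg h0 (pow_pos hq0 k).le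
    linarith [key k]
  · rw [Metric.mem_closedBall, dist_comm]
    exact hωx n
  · rw [Metric.mem_closedBall, dist_comm]
    exact hωy n

/-- In the unit interval one can move towards any given point. -/
theorem unitInterval_exists_dist_le (x z : Set.Icc (0 : ℝ) 1) (R : ℝ) (hR : 0 ≤ R) :
    ∃ y, dist x y ≤ R ∧ dist y z ≤ max 0 (dist x z - R) := by
  obtain ⟨x, hx0, hx1⟩ := x
  obtain ⟨z, hz0, hz1⟩ := z
  simp only [Subtype.dist_eq, Real.dist_eq, Subtype.exists, Set.mem_Icc]
  by_cases h : |x - z| ≤ R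
  · exact ⟨z, ⟨hz0, hz1⟩, h, by simp⟩
  · rw [not_le] at h
    rcases le_total x z with hxz | hxz
    · rw [abs_of_nonpos (by linarith)] at h ⊢
      refine ⟨x + R, ⟨by linarith, by linarith⟩, ?_, le_max_of_le_right ?_⟩
      · rw [abs_of_nonpos (by linarith)]; linarith
      · rw [abs_of_nonpos (by linarith)]; linarith
    · rw [abs_of_nonneg (by linarith)] at h ⊢
      refine ⟨x - R, ⟨by linarith, by linarith⟩, ?_, le_max_of_le_right ?_⟩
      · rw [abs_of_nonneg (by linarith)]; linarith
      · rw [abs_of_nonneg (by linarith)]; linarith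

/-! ## Cylinders of the `b`-expansion -/

/-- `IsCylinder b n c k`: the interval `[c, c + b⁻ⁿ T^k 1)` is a cylinder of level `n` that `T^n`
maps onto `[0, T^k 1)`, where `T = betaMap b`. It is full if `k = 0`. -/
inductive IsCylinder (b : ℝ) : ℕ → ℝ → ℕ → Prop
  | zero : IsCylinder b 0 0 0
  | full {n : ℕ} {c : ℝ} {k : ℕ} (j : ℕ) (hj : j < bExpansion b 1 k) (h : IsCylinder b n c k) :
      IsCylinder b (n + 1) (c + j / b ^ (n + 1)) 0
  | last {n : ℕ} {c : ℝ} {k : ℕ} (ht : 0 < (betaMap b)^[k + 1] 1) (h : IsCylinder b n c k) :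
      IsCylinder b (n + 1) (c + bExpansion b 1 k / b ^ (n + 1)) (k + 1)

theorem div_pow_eq_mul_div_pow_succ {b : ℝ} (hb : 0 < b) (n : ℕ) (x : ℝ) :
    x / b ^ n = b * x / b ^ (n + 1) := by
  field_simp
  ring

theorem iterate_betaMap_one_mem_Icc (b : ℝ) (k : ℕ) :
    (betaMap b)^[k] 1 ∈ Set.Icc (0 : ℝ) 1 := by
  cases k with
  | zero => simp
  | succ k =>
    rw [Function.iterate_succ_apply']
    exact ⟨Int.fract_nonneg _, (Int.fract_lt_one _).le⟩

/-- The first digit and the remainder of `b * T^k 1`. -/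
theorem mul_iterate_betaMap_one {b : ℝ} (hb : 1 < b) (k : ℕ) :
    b * (betaMap b)^[k] 1 = bExpansion b 1 k + (betaMap b)^[k + 1] 1 := by
  have h0 : 0 ≤ b * (betaMap b)^[k] 1 :=
    mul_nonneg (by linarith) (iterate_betaMap_one_mem_Icc b k).1
  rw [Function.iterate_succ_apply', betaMap, Int.fract, bExpansion, natCast_floor_eq_intCast_floor h0]
  ring

theorem one_le_bExpansion_one_zero {b : ℝ} (hb : 1 < b) : 1 ≤ bExpansion b 1 0 := by
  rw [bExpansion]
  exact Nat.le_floor (by simpa using hb.le)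

namespace IsCylinder

variable {b : ℝ} {n : ℕ} {c : ℝ} {k : ℕ}

theorem iterate_one_pos (h : IsCylinder b n c k) : 0 < (betaMap b)^[k] 1 := by
  cases h with
  | zero => simp
  | full => simp
  | last ht => exact ht

/-- `T^n` is affine on a cylinder of level `n`. -/
theorem iterate_eq (hb : 1 < b) (h : IsCylinder b n c k) :
    0 ≤ c ∧ c + (betaMap b)^[k] 1 / b ^ n ≤ 1 ∧
      ∀ y, c ≤ y → y < c + (betaMap b)^[k] 1 / b ^ n →
        (betaMap b)^[n] y = b ^ n * (y - c) := by
  have hb0 : 0 < b := by linarith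
  induction h with
  | zero => simp
  | @full n c k j hj h ih =>
    obtain ⟨h0, h1, h2⟩ := ih
    have hp : 0 < b ^ n := pow_pos hb0 n
    have hp' : 0 < b ^ (n + 1) := pow_pos hb0 _
    have ht := mul_iterate_betaMap_one hb k
    have ht' := (iterate_betaMap_one_mem_Icc b (k + 1)).1
    have hj' : (j : ℝ) + 1 ≤ bExpansion b 1 k := by exact_mod_cast hj
    have hle : c + j / b ^ (n + 1) + 1 / b ^ (n + 1) ≤ c + (betaMap b)^[k] 1 / b ^ n := by
      rw [div_pow_eq_mul_div_pow_succ hb0 n ((betaMap b)^[k] 1), add_assoc, ← add_div]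
      gcongr
      linarith
    have hjn : 0 ≤ (j : ℝ) / b ^ (n + 1) := by positivity
    refine ⟨by linarith, by simpa using hle.trans h1, fun y hy1 hy2 => ?_⟩
    simp only [Function.iterate_zero, id] at hy2
    rw [Function.iterate_succ_apply', h2 y (by linarith) (by linarith), betaMap]
    have e1 : (j : ℝ) ≤ b ^ (n + 1) * (y - c) := by
      rw [← div_le_iff₀' hp']; linarith
    have e2 : b ^ (n + 1) * (y - c) < j + 1 := by
      rw [← lt_div_iff₀' hp', add_div]; linarith
    have e3 : b ^ (n + 1) * (y - (c + j / b ^ (n + 1))) = b ^ (n + 1) * (y - c) - j := by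
      field_simp
      ring
    rw [e3, Int.fract_eq_iff]
    refine ⟨by linarith, by linarith, j, ?_⟩
    push_cast
    ring
  | @last n c k htk h ih =>
    obtain ⟨h0, h1, h2⟩ := ih
    have hp : 0 < b ^ n := pow_pos hb0 n
    have hp' : 0 < b ^ (n + 1) := pow_pos hb0 _
    have ht := mul_iterate_betaMap_one hb k
    have ht' := iterate_betaMap_one_mem_Icc b (k + 1)
    have hle : c + bExpansion b 1 k / b ^ (n + 1) + (betaMap b)^[k + 1] 1 / b ^ (n + 1) =
        c + (betaMap b)^[k] 1 / b ^ n := by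
      rw [div_pow_eq_mul_div_pow_succ hb0 n ((betaMap b)^[k] 1), ht, add_div, add_assoc]
    have hjn : 0 ≤ (bExpansion b 1 k : ℝ) / b ^ (n + 1) := by positivity
    refine ⟨by linarith, by linarith, fun y hy1 hy2 => ?_⟩
    rw [Function.iterate_succ_apply', h2 y (by linarith) (by linarith), betaMap]
    have e1 : (bExpansion b 1 k : ℝ) ≤ b ^ (n + 1) * (y - c) := by
      rw [← div_le_iff₀' hp']; linarith
    have e2 : b ^ (n + 1) * (y - c) < bExpansion b 1 k + (betaMap b)^[k + 1] 1 := by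
      rw [← lt_div_iff₀' hp', add_div]; linarith
    have e3 : b ^ (n + 1) * (y - (c + bExpansion b 1 k / b ^ (n + 1))) =
        b ^ (n + 1) * (y - c) - bExpansion b 1 k := by
      field_simp
      ring
    rw [e3, Int.fract_eq_iff]
    refine ⟨by linarith, by linarith [ht'.2], bExpansion b 1 k, ?_⟩
    push_cast
    ring

/-- The cylinders of level `n` cover `[0, 1)`. -/
theorem exists_mem (hb : 1 < b) (n : ℕ) {x : ℝ} (hx : x ∈ Set.Ico (0 : ℝ) 1) :
    ∃ c k, IsCylinder b n c k ∧ c ≤ x ∧ x < c + (betaMap b)^[k] 1 / b ^ n := by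
  have hb0 : 0 < b := by linarith
  induction n with
  | zero => exact ⟨0, 0, .zero, hx.1, by simpa using hx.2⟩
  | succ n ih =>
    obtain ⟨c, k, h, h1, h2⟩ := ih
    have hp : 0 < b ^ n := pow_pos hb0 n
    have hp' : 0 < b ^ (n + 1) := pow_pos hb0 _
    have ht := mul_iterate_betaMap_one hb k
    have hle : c + bExpansion b 1 k / b ^ (n + 1) + (betaMap b)^[k + 1] 1 / b ^ (n + 1) =
        c + (betaMap b)^[k] 1 / b ^ n := by
      rw [div_pow_eq_mul_div_pow_succ hb0 n ((betaMap b)^[k] 1), ht, add_div, add_assoc]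
    have h0 : 0 ≤ b ^ (n + 1) * (x - c) := mul_nonneg hp'.le (by linarith)
    by_cases hj : ⌊b ^ (n + 1) * (x - c)⌋₊ < bExpansion b 1 k
    · refine ⟨_, 0, .full _ hj h, ?_, ?_⟩
      · have := Nat.floor_le h0
        rw [← div_le_iff₀' hp'] at this
        linarith
      · have := Nat.lt_floor_add_one (b ^ (n + 1) * (x - c))
        rw [← lt_div_iff₀' hp', add_div] at this
        simp only [Function.iterate_zero, id]
        linarith
    · rw [not_lt] at hj
      have h3 : (bExpansion b 1 k : ℝ) ≤ b ^ (n + 1) * (x - c) := (Nat.le_floor_iff h0).1 hj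
      rw [← div_le_iff₀' hp'] at h3
      have hpos : 0 < (betaMap b)^[k + 1] 1 / b ^ (n + 1) := by linarith
      exact ⟨_, k + 1, .last ((div_pos_iff_of_pos_right hp').1 hpos) h, by linarith, by linarith⟩

/-- The rightmost subcylinder of a cylinder. -/
theorem exists_last (hb : 1 < b) (h : IsCylinder b n c k) :
    ∃ c' k', IsCylinder b (n + 1) c' k' ∧
      c' + (betaMap b)^[k'] 1 / b ^ (n + 1) = c + (betaMap b)^[k] 1 / b ^ n ∧
      (k' = 0 ∨ k' = k + 1) := by
  have hb0 : 0 < b := by linarith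
  have ht := mul_iterate_betaMap_one hb k
  have hdiv := div_pow_eq_mul_div_pow_succ hb0 n ((betaMap b)^[k] 1)
  rcases (iterate_betaMap_one_mem_Icc b (k + 1)).1.eq_or_lt with h0 | h0
  -- Here the child with the last digit is empty, so the full child before it reaches the right
  -- endpoint.
  · have hpos : 0 < b * (betaMap b)^[k] 1 := mul_pos hb0 h.iterate_one_pos
    rw [← h0, add_zero] at ht
    rw [ht] at hpos
    obtain ⟨j, hj⟩ : ∃ j, bExpansion b 1 k = j + 1 :=
      Nat.exists_eq_succ_of_ne_zero (by exact_mod_cast hpos.ne')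
    refine ⟨_, 0, .full j (by omega) h, ?_, Or.inl rfl⟩
    rw [hdiv, ht, hj]
    push_cast
    simp only [Function.iterate_zero, id]
    ring
  · refine ⟨_, k + 1, .last h0 h, ?_, Or.inr rfl⟩
    rw [hdiv, ht]
    ring

/-- The left neighbour of a cylinder that is not full belongs to a smaller iterate of `T`, and the
expansion of `1` has correspondingly many zeros. -/
theorem exists_left (hb : 1 < b) (h : IsCylinder b n c k) :
    (c = 0 ∧ k = 0) ∨ ∃ c' p, IsCylinder b n c' p ∧ c' + (betaMap b)^[p] 1 / b ^ n = c ∧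
      (k = 0 ∨ ∃ s, k = s + 1 + p ∧ ∀ j < p, bExpansion b 1 (s + 1 + j) = 0) := by
  induction h with
  | zero => exact Or.inl ⟨rfl, rfl⟩
  | @full n c k j hj h ih =>
    cases j with
    | zero =>
      rcases ih with ⟨rfl, rfl⟩ | ⟨c', p, h', hc', -⟩
      · exact Or.inl ⟨by simp, rfl⟩
      · obtain ⟨c'', p', h'', hc'', -⟩ := h'.exists_last hb
        exact Or.inr ⟨c'', p', h'', by simp [hc'', hc'], Or.inl rfl⟩
    | succ j =>
      refine Or.inr ⟨_, 0, .full j (by omega) h, ?_, Or.inl rfl⟩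
      push_cast
      simp only [Function.iterate_zero, id]
      ring
  | @last n c k ht h ih =>
    rcases he : bExpansion b 1 k with _ | j
    · have hk : k ≠ 0 := by
        rintro rfl
        have := one_le_bExpansion_one_zero hb
        omega
      rcases ih with ⟨-, hk'⟩ | ⟨c', p, h', hc', hk' | ⟨s, hs, hz⟩⟩
      · exact absurd hk' hk
      · exact absurd hk' hk
      · obtain ⟨c'', p', h'', hc'', hp'⟩ := h'.exists_last hb
        refine Or.inr ⟨c'', p', h'', by simp [hc'', hc'], Or.inr ?_⟩
        rcases hp' with rfl | rfl
        · exact ⟨k, rfl, by simp⟩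
        · refine ⟨s, by omega, fun i hi => ?_⟩
          rcases Nat.lt_succ_iff_lt_or_eq.1 hi with hi | rfl
          · exact hz i hi
          · rw [← hs, he]
    · refine Or.inr ⟨_, 0, .full j (by omega) h, ?_, Or.inr ⟨k, rfl, by simp⟩⟩
      push_cast
      simp only [Function.iterate_zero, id]
      ring

end IsCylinder

/-! ### Blocks of zeros in the expansion of 1 -/

/-- Since `b - ⌊b⌋ = T 1`, this turns `K_b` into a statement about the expansion of 1 after its
first digit. -/
theorem bExpansion_fract (b : ℝ) (j : ℕ) : bExpansion b (Int.fract b) j = bExpansion b 1 (j + 1) := by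
  simp [bExpansion, betaMap]

/-- A nonzero iterate of `1` is followed by a nonzero digit. -/
theorem exists_bExpansion_one_ne_zero {b : ℝ} (hb : 1 < b) {k : ℕ}
    (hk : 0 < (betaMap b)^[k] 1) : ∃ i, bExpansion b 1 (k + i) ≠ 0 := by
  by_contra! hcon
  -- Along zero digits `T` is multiplication by `b`, so the iterates would leave `[0, 1]`.
  have hpow : ∀ i, (betaMap b)^[k + i] 1 = b ^ i * (betaMap b)^[k] 1 := by
    intro i
    induction i with
    | zero => simp
    | succ i ih =>
      have := mul_iterate_betaMap_one hb (k + i)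
      rw [hcon i, ih] at this
      rw [← add_assoc]
      push_cast at this
      rw [pow_succ]
      linarith
  obtain ⟨i, hi⟩ := pow_unbounded_of_one_lt (1 / (betaMap b)^[k] 1) hb
  rw [div_lt_iff₀ hk, ← hpow i] at hi
  exact absurd (iterate_betaMap_one_mem_Icc b (k + i)).2 (not_le.2 hi)

/-- Blocks of zeros in the expansion of `1` before a nonzero iterate are bounded by `K_b`. -/
theorem le_of_maxZeroRun_eq {b : ℝ} (hb : 1 < b) {K : ℕ} (hK : maxZeroRun b = (K : ℕ∞)) {s p : ℕ}
    (hpos : 0 < (betaMap b)^[s + 1 + p] 1)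
    (hz : ∀ j < p, bExpansion b 1 (s + 1 + j) = 0) : p ≤ K := by
  obtain ⟨i, hi⟩ := exists_bExpansion_one_ne_zero hb hpos
  -- A nonzero digit follows the block, so the block counts towards `K_b`.
  have hlen : ((s + p : ℕ) : ℕ∞) ≤ fractLength b := by
    have h1 : ((s + p + i + 1 : ℕ) : ℕ∞) ≤ fractLength b := by
      refine le_iSup₂_of_le (s + p + i) ?_ le_rfl
      rw [bExpansion_fract]
      convert hi using 2
      omega
    refine le_trans ?_ h1
    exact_mod_cast (by omega : s + p ≤ s + p + i + 1)
  have : (p : ℕ∞) ≤ maxZeroRun b := by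
    refine le_iSup_of_le s (le_iSup₂_of_le p ⟨hlen, fun j hj => ?_⟩ le_rfl)
    rw [bExpansion_fract, ← hz j hj]
    congr 1
    omega
  rw [hK] at this
  exact_mod_cast this

/-! ### Full cylinders near a given point -/

namespace IsCylinder

variable {b : ℝ} {n : ℕ} {c : ℝ} {k : ℕ}

/-- The new index `p` is the length of a block of zeros, hence at most `K` however large `k` is. -/
theorem exists_left_lt (hb : 1 < b) {K : ℕ} (hK : maxZeroRun b = (K : ℕ∞))
    (h : IsCylinder b n c k) (hk : k ≠ 0) :
    ∃ c' p, IsCylinder b n c' p ∧ c' ≤ c ∧ c ≤ c' + 1 / b ^ n ∧ p < k ∧ p ≤ K := by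
  have hp : 0 < b ^ n := pow_pos (by linarith) n
  rcases h.exists_left hb with ⟨-, hk'⟩ | ⟨c', p, h', hc', hk' | ⟨s, rfl, hz⟩⟩
  · exact absurd hk' hk
  · exact absurd hk' hk
  · have hi := iterate_betaMap_one_mem_Icc b p
    have h1 : 0 ≤ (betaMap b)^[p] 1 / b ^ n := div_nonneg hi.1 hp.le
    have h2 : (betaMap b)^[p] 1 / b ^ n ≤ 1 / b ^ n := by
      gcongr
      exact hi.2
    exact ⟨c', p, h', by linarith, by linarith, by omega,
      le_of_maxZeroRun_eq hb hK h.iterate_one_pos hz⟩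

/-- Each step to the left costs at most `b⁻ⁿ` and lowers the index, so `k` steps suffice. -/
theorem exists_full_left (hb : 1 < b) {K : ℕ} (hK : maxZeroRun b = (K : ℕ∞))
    (h : IsCylinder b n c k) :
    ∃ c', IsCylinder b n c' 0 ∧ c' ≤ c ∧ c ≤ c' + k * (1 / b ^ n) := by
  induction k using Nat.strong_induction_on generalizing c with
  | _ k ih =>
    rcases eq_or_ne k 0 with rfl | hk
    · exact ⟨c, h, le_rfl, by simp⟩
    · obtain ⟨c', p, h', h1, h2, hpk, -⟩ := h.exists_left_lt hb hK hk
      obtain ⟨c'', h'', h3, h4⟩ := ih p hpk h'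
      refine ⟨c'', h'', h3.trans h1, ?_⟩
      have hb' : 0 ≤ 1 / b ^ n := by
        have : 0 < b := by linarith
        positivity
      have : ((p : ℝ) + 1) * (1 / b ^ n) ≤ k * (1 / b ^ n) :=
        mul_le_mul_of_nonneg_right (by exact_mod_cast hpk) hb'
      linarith

/-- Every point of `[0, 1)` has a full cylinder of level `n` at distance at most `(K + 2) b⁻ⁿ` to
its left. -/
theorem exists_full (hb : 1 < b) {K : ℕ} (hK : maxZeroRun b = (K : ℕ∞)) (n : ℕ) {x : ℝ}
    (hx : x ∈ Set.Ico (0 : ℝ) 1) :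
    ∃ c, IsCylinder b n c 0 ∧ c ≤ x ∧ x ≤ c + (K + 2) * (1 / b ^ n) := by
  have hp : 0 < 1 / b ^ n := by
    have : 0 < b := by linarith
    positivity
  obtain ⟨c, k, h, h1, h2⟩ := exists_mem hb n hx
  have h3 : (betaMap b)^[k] 1 / b ^ n ≤ 1 / b ^ n := by
    have : 0 < b := by linarith
    gcongr
    exact (iterate_betaMap_one_mem_Icc b k).2
  have hK0 : (0 : ℝ) ≤ K * (1 / b ^ n) := by positivity
  rcases eq_or_ne k 0 with rfl | hk
  · exact ⟨c, h, h1, by linarith⟩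
  -- The `K + 2` lengths are the cylinder of `x`, its left neighbour, and at most `p ≤ K` further
  -- steps.
  · obtain ⟨c', p, h', h4, h5, -, hpK⟩ := h.exists_left_lt hb hK hk
    obtain ⟨c'', h'', h6, h7⟩ := h'.exists_full_left hb hK
    refine ⟨c'', h'', by linarith, ?_⟩
    have : (p : ℝ) * (1 / b ^ n) ≤ K * (1 / b ^ n) :=
      mul_le_mul_of_nonneg_right (by exact_mod_cast hpK) hp.le
    linarith

/-- The digit `d` occupies an interval of length `b⁻⁽ⁿ⁺¹⁾` in a full cylinder of level `n`. -/
theorem mem_digitSet (hb : 1 < b) {d : ℕ} (hd : (d : ℝ) + 1 ≤ b) (h : IsCylinder b n c 0) {y : ℝ}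
    (h1 : c + d / b ^ (n + 1) ≤ y) (h2 : y < c + (d + 1) / b ^ (n + 1)) : y ∈ digitSet b d := by
  have hb0 : 0 < b := by linarith
  have hp : 0 < b ^ n := pow_pos hb0 n
  have hp' : 0 < b ^ (n + 1) := pow_pos hb0 _
  obtain ⟨hc0, hc1, hc⟩ := h.iterate_eq hb
  simp only [Function.iterate_zero, id] at hc1 hc
  have hle : ((d : ℝ) + 1) / b ^ (n + 1) ≤ 1 / b ^ n := by
    rw [div_le_div_iff₀ hp' hp, pow_succ, one_mul, mul_comm]
    gcongr
  have hd0 : 0 ≤ (d : ℝ) / b ^ (n + 1) := by positivity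
  refine ⟨⟨by linarith, by linarith⟩, n, ?_⟩
  rw [bExpansion, hc y (by linarith) (by linarith), ← mul_assoc, ← pow_succ']
  have e1 : (d : ℝ) ≤ b ^ (n + 1) * (y - c) := by
    rw [← div_le_iff₀' hp']; linarith
  have e2 : b ^ (n + 1) * (y - c) < d + 1 := by
    rw [← lt_div_iff₀' hp']; linarith
  exact (Nat.floor_eq_iff (le_trans d.cast_nonneg e1)).2 ⟨e1, e2⟩

end IsCylinder

/-! ### Intervals of the digit set near a given point -/

/-- A digit that does not exceed the minimal digit of the quasi-greedy expansion of `1` is at most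
`b - 1`. -/
theorem add_one_le_of_le_minQuasiGreedyDigit {b : ℝ} (hb : 1 < b) {d : ℕ}
    (hd : d ≤ minQuasiGreedyDigit b) : (d : ℝ) + 1 ≤ b := by
  have hb0 : 0 < b := by linarith
  have hdj : ∀ j, d ≤ quasiGreedy b j := fun j => hd.trans (Nat.sInf_le ⟨j, rfl⟩)
  -- A point close enough to 1 on the left shares the first `n` quasi-greedy digits, all at least
  -- `d`. As `n → ∞` the geometric series gives `d / (b - 1) ≤ 1`.
  have hsum : ∀ n, ∑ k ∈ Finset.range n, (d : ℝ) / b ^ (k + 1) ≤ 1 := by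
    intro n
    have hev : ∀ᶠ x in 𝓝[<] (1 : ℝ), ∀ k ∈ Finset.range n, bExpansion b x k = quasiGreedy b k := by
      rw [Filter.eventually_all_finset]
      intro k _
      have := (tendsto_pi_nhds.1 (tendsto_quasiGreedy hb)) k
      rwa [nhds_discrete, tendsto_pure] at this
    have hmem : ∀ᶠ x in 𝓝[<] (1 : ℝ), x ∈ Set.Ico (0 : ℝ) 1 :=
      Ico_mem_nhdsLT one_pos
    obtain ⟨x, hx, hx1⟩ := (hev.and hmem).exists
    have h1 := (bExpansion_spec hb hx1 n).1
    have h2 := nonneg_of_mul_nonneg_right h1 (pow_pos hb0 n)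
    have h3 : ∑ k ∈ Finset.range n, (d : ℝ) / b ^ (k + 1) ≤
        ∑ k ∈ Finset.range n, (bExpansion b x k : ℝ) / b ^ (k + 1) := by
      refine Finset.sum_le_sum fun k hk => ?_
      gcongr
      rw [hx k hk]
      exact hdj k
    linarith [hx1.2]
  have hgeom : ∀ n, ∑ k ∈ Finset.range n, (d : ℝ) / b ^ (k + 1) =
      d / (b - 1) * (1 - b⁻¹ ^ n) := by
    intro n
    have hb1 : b - 1 ≠ 0 := by linarith
    induction n with
    | zero => simp
    | succ n ih =>
      rw [Finset.sum_range_succ, ih, inv_pow, inv_pow]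
      field_simp
      ring
  have hlim : Tendsto (fun n : ℕ => (d : ℝ) / (b - 1) * (1 - b⁻¹ ^ n)) atTop
      (𝓝 (d / (b - 1) * (1 - 0))) :=
    ((tendsto_pow_atTop_nhds_zero_of_lt_one (by positivity) (inv_lt_one_of_one_lt₀ hb)).const_sub
      1).const_mul _
  have := le_of_tendsto' hlim fun n => (hgeom n).symm.trans_le (hsum n)
  rw [sub_zero, mul_one, div_le_one (by linarith)] at this
  linarith

/-- Every point of `[0, 1]` is at distance at most `(K b + 2 b) δ` from the midpoint of an interval of
length `δ = b⁻⁽ⁿ⁺¹⁾` in `C_b[d]`. -/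
theorem exists_closedBall_subset_digitSet {b : ℝ} (hb : 1 < b) {K : ℕ}
    (hK : maxZeroRun b = (K : ℕ∞)) {d : ℕ} (hd : d ≤ minQuasiGreedyDigit b) (n : ℕ) {h : ℝ}
    (h0 : 0 ≤ h) (hh : h < 1 / b ^ (n + 1) / 2) (x : Set.Icc (0 : ℝ) 1) :
    ∃ z : Set.Icc (0 : ℝ) 1, dist x z ≤ (K * b + 2 * b) * (1 / b ^ (n + 1)) ∧
      Metric.closedBall z h ⊆ {x : Set.Icc (0 : ℝ) 1 | (x : ℝ) ∈ digitSet b d} := by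
  have hb0 : 0 < b := by linarith
  obtain ⟨x, hx0, hx1⟩ := x
  have hd' := add_one_le_of_le_minQuasiGreedyDigit hb hd
  set δ : ℝ := 1 / b ^ (n + 1) with hδ
  have hδ0 : 0 < δ := by positivity
  have hbn : 1 / b ^ n = b * δ := by
    rw [div_pow_eq_mul_div_pow_succ hb0, hδ, mul_one_div, mul_one]
  -- The point 1 lies in no cylinder. The shift by up to `δ / 2` is absorbed by the `δ / 2` in the
  -- midpoint below.
  obtain ⟨x', hx', hx'x, hxx'⟩ : ∃ x' ∈ Set.Ico (0 : ℝ) 1, x' ≤ x ∧ x ≤ x' + δ / 2 := by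
    rcases hx1.eq_or_lt with rfl | hlt
    · refine ⟨max 0 (1 - δ / 2), ⟨le_max_left _ _, max_lt one_pos (by linarith)⟩,
        max_le zero_le_one (by linarith), ?_⟩
      linarith [le_max_right 0 (1 - δ / 2)]
    · exact ⟨x, ⟨hx0, hlt⟩, le_rfl, by linarith⟩
  obtain ⟨c, hc, hcx, hxc⟩ := IsCylinder.exists_full hb hK n hx'
  obtain ⟨hc0, hc1, -⟩ := hc.iterate_eq hb
  simp only [Function.iterate_zero, id] at hc1
  rw [hbn] at hxc hc1
  have hdδ : 0 ≤ d * δ := by positivity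
  have hdδ' : (d + 1) * δ ≤ b * δ := mul_le_mul_of_nonneg_right hd' hδ0.le
  have hKb : 0 ≤ K * (b * δ) := by positivity
  have hbδ : 0 < b * δ := by positivity
  refine ⟨⟨c + d * δ + δ / 2, by linarith, by linarith⟩, ?_, ?_⟩
  · rw [Subtype.dist_eq, Real.dist_eq, abs_le]
    constructor <;> dsimp only <;> linarith
  · rintro ⟨y, hy⟩ hyz
    rw [Metric.mem_closedBall, Subtype.dist_eq, Real.dist_eq, abs_le] at hyz
    dsimp only at hyz
    refine hc.mem_digitSet hb hd' ?_ ?_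
    · rw [div_eq_mul_one_div, ← hδ]
      linarith
    · rw [div_eq_mul_one_div, ← hδ]
      linarith

/-! ## Choice of the scale -/

/-- The multiples `n θ`, `n ≥ N`, of an irrational number `θ` are dense modulo `1`. -/
theorem Irrational.exists_natCast_mul_add_intCast_mem_Ioo {θ : ℝ} (hθ : Irrational θ) {s t : ℝ}
    (hst : s < t) (N : ℕ) : ∃ n, N ≤ n ∧ ∃ m : ℤ, n * θ + m ∈ Set.Ioo s t := by
  have hdense : DenseRange (· • (θ : AddCircle (1 : ℝ)) : ℤ → AddCircle (1 : ℝ)) :=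
    AddCircle.denseRange_zsmul_coe_iff.2 (by simpa using hθ)
  -- In a compact group the forward orbit accumulates at every point of the closure of the generated
  -- subgroup; this provides `n ≥ N`.
  have hcl : MapClusterPt (((s + t) / 2 : ℝ) : AddCircle (1 : ℝ)) atTop
      (· • (θ : AddCircle (1 : ℝ)) : ℕ → AddCircle (1 : ℝ)) :=
    ((mapClusterPt_atTop_nsmul_tfae _ _).out 0 3).2 (hdense _)
  have hopen : IsOpen ((fun x : ℝ => (x : AddCircle (1 : ℝ))) '' Set.Ioo s t) :=
    QuotientAddGroup.isOpenMap_coe _ isOpen_Ioo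
  have hfreq := hcl.frequently
    (hopen.mem_nhds ⟨(s + t) / 2, ⟨by linarith, by linarith⟩, rfl⟩)
  obtain ⟨n, hn, y, hy, hyn⟩ := frequently_atTop.1 hfreq N
  refine ⟨n, hn, ?_⟩
  have hyn' : ((y - n * θ : ℝ) : AddCircle (1 : ℝ)) = 0 := by
    rw [AddCircle.coe_sub, sub_eq_zero, ← nsmul_eq_mul, AddCircle.coe_nsmul]
    exact hyn
  obtain ⟨m, hm⟩ := (AddCircle.coe_eq_zero_iff 1).1 hyn'
  refine ⟨m, ?_⟩
  rw [zsmul_one] at hm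
  rwa [hm, add_sub_cancel]

/-- A winning condition in terms of the length `δ = b⁻ᵐ` of the intervals with digit `d`. -/
theorem schmidtWinningFrom_digitSet {b : ℝ} (hb : 1 < b) {K : ℕ}
    (hK : maxZeroRun b = (K : ℕ∞)) {d : ℕ} (hd : d ≤ minQuasiGreedyDigit b) {α β ρ : ℝ}
    (hα0 : 0 < α) (hα1 : α < 1) (hβ0 : 0 < β) (hβ1 : β < 1) (hρ : 0 < ρ) {N : ℕ}
    (hN : (α * β) ^ N * ρ < 1) (m : ℤ)
    (h1 : (K * b + 2 * b) * b ^ m ≤ (1 - α) * ((α * β) ^ N * ρ))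
    (h2 : 2 * (α * ((α * β) ^ N * ρ) * (1 - 2 * β + α * β)) < b ^ m * (1 - α * β)) :
    SchmidtWinningFrom α β ρ {x : Set.Icc (0 : ℝ) 1 | (x : ℝ) ∈ digitSet b d} := by
  have hb0 : 0 < b := by linarith
  have hq1 : 0 < 1 - α * β := by nlinarith
  have hbm : 0 < b ^ m := zpow_pos hb0 m
  obtain ⟨n, hn⟩ : ∃ n : ℕ, b ^ m = 1 / b ^ (n + 1) := by
    -- For `m ≥ 0` the left side of `h1` would exceed 1, while Bob's radius is below 1.
    have hm : m < 0 := by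
      by_contra! hm
      have h3 : 1 ≤ b ^ m := one_le_zpow₀ hb.le hm
      have h4 : 0 ≤ K * b * b ^ m := by positivity
      have h5 : 1 < b * b ^ m := by nlinarith
      have h6 : 0 < α * ((α * β) ^ N * ρ) := by positivity
      linarith
    refine ⟨(-m - 1).toNat, ?_⟩
    rw [one_div, ← zpow_natCast, ← zpow_neg]
    congr 1
    omega
  set g := α * ((α * β) ^ N * ρ) * (1 - 2 * β + α * β) with hg
  -- The drift `g` is negative for large `β`; Alice then returns to `z` in every round and `h = 0`
  -- suffices.
  refine schmidtWinningFrom_of_forall_exists_closedBall_subset unitInterval_exists_dist_le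
    hα0 hα1 hβ0 hβ1 hρ N (h := max 0 (g / (1 - α * β))) (le_max_left _ _) ?_ fun x => ?_
  · rw [← hg, ← div_le_iff₀ hq1]
    exact le_max_right _ _
  · obtain ⟨z, hz, hzS⟩ := exists_closedBall_subset_digitSet hb hK hd n
      (h := max 0 (g / (1 - α * β))) (le_max_left _ _) (by
        rw [← hn]
        refine max_lt (by linarith) ?_
        rw [div_lt_iff₀ hq1]
        linarith) x
    rw [← hn] at hz
    exact ⟨z, hz.trans h1, hzS⟩

theorem exists_forall_pow_mul_lt_one {q : ℝ} (hq0 : 0 < q) (hq1 : q < 1) (ρ : ℝ) :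
    ∃ N, ∀ n, N ≤ n → q ^ n * ρ < 1 := by
  have : Tendsto (fun n => q ^ n * ρ) atTop (𝓝 0) := by
    simpa using (tendsto_pow_atTop_nhds_zero_of_lt_one hq0.le hq1).mul_const ρ
  exact eventually_atTop.1 (this.eventually_lt_const one_pos)

/-- Logarithms to base `b` turn this into the density of `n log_b q` modulo 1. -/
theorem exists_zpow_mem_Ioo_of_irrational_logb {b : ℝ} (hb : 1 < b) {q ρ : ℝ} (hq0 : 0 < q)
    (hρ : 0 < ρ) (hq : Irrational (Real.logb b q)) {u v : ℝ} (hu : 0 < u) (huv : u < v) (N : ℕ) :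
    ∃ n, N ≤ n ∧ ∃ m : ℤ, b ^ m ∈ Set.Ioo (u * (q ^ n * ρ)) (v * (q ^ n * ρ)) := by
  have hb0 : 0 < b := by linarith
  have hv : 0 < v := hu.trans huv
  obtain ⟨n, hn, m, hm1, hm2⟩ := hq.exists_natCast_mul_add_intCast_mem_Ioo
    (s := -Real.logb b (v * ρ)) (t := -Real.logb b (u * ρ))
    (neg_lt_neg (Real.logb_lt_logb hb (by positivity) (by gcongr))) N
  have hlog : ∀ w, 0 < w →
      Real.logb b (w * (q ^ n * ρ)) = n * Real.logb b q + Real.logb b (w * ρ) := by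
    intro w hw
    rw [mul_left_comm, Real.logb_mul (by positivity) (by positivity), Real.logb_pow]
  have hlogm : Real.logb b (b ^ (-m)) = -m := by
    rw [← Real.rpow_intCast, Real.logb_rpow hb0 hb.ne']
    push_cast
    ring
  refine ⟨n, hn, -m, ?_, ?_⟩
  · rw [← Real.logb_lt_logb_iff hb (by positivity) (by positivity), hlog u hu, hlogm]
    linarith
  · rw [← Real.logb_lt_logb_iff hb (by positivity) (by positivity), hlog v hv, hlogm]
    linarith

/-! ### The winning theorem -/

theorem theorem2p6 (b : ℝ) (hb : 1 < b) (K : ℕ) (hK : maxZeroRun b = (K : ℕ∞))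
    (d : ℕ) (hd : d ≤ minQuasiGreedyDigit b) :
    (∀ α β : ℝ, 0 < α → α < 1 → 0 < β → β < 1 → Irrational (Real.logb b (α * β)) →
      winningBound b K α < β →
        SchmidtWinning α β {x : Set.Icc (0 : ℝ) 1 | (x : ℝ) ∈ digitSet b d}) ∧
    (∀ α : ℝ, 0 < α → α < 1 → α < 1 / (2 * K * b ^ 2 + 4 * b ^ 2 + 1) →
        SchmidtAlphaWinning α {x : Set.Icc (0 : ℝ) 1 | (x : ℝ) ∈ digitSet b d}) := by
  have hb0 : 0 < b := by linarith
  have hL : 2 < K * b + 2 * b := by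
    have : 0 ≤ K * b := by positivity
    linarith
  constructor
  · intro α β hα0 hα1 hβ0 hβ1 hirr hA ρ hρ
    have hq0 : 0 < α * β := mul_pos hα0 hβ0
    have hq1 : α * β < 1 := by nlinarith
    rw [winningBound] at hA
    set L := K * b + 2 * b with hLdef
    have hden : 0 < (4 * L - 1) - α * (2 * L - 1) := by nlinarith
    rw [div_lt_iff₀ (mul_pos hα0 hden)] at hA
    obtain ⟨N₀, hN₀⟩ := exists_forall_pow_mul_lt_one hq0 hq1 ρ
    have hv : 0 < (1 - α) / L := div_pos (by linarith) (by linarith)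
    -- With denominators cleared, this is `hA`.
    have hguv : 2 * α * (1 - 2 * β + α * β) / (1 - α * β) < (1 - α) / L := by
      rw [div_lt_div_iff₀ (by linarith) (by linarith)]
      linarith
    obtain ⟨N, hN, m, hm1, hm2⟩ := exists_zpow_mem_Ioo_of_irrational_logb hb hq0 hρ hirr
      -- The second term keeps the lower end positive when the first is not.
      (u := max (2 * α * (1 - 2 * β + α * β) / (1 - α * β)) ((1 - α) / L / 2))
      (lt_max_of_lt_right (by linarith)) (max_lt hguv (by linarith)) N₀
    have hr : 0 < (α * β) ^ N * ρ := by positivity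
    refine schmidtWinningFrom_digitSet hb hK hd hα0 hα1 hβ0 hβ1 hρ (hN₀ N hN) m ?_ ?_
    · rw [← hLdef]
      rw [div_mul_eq_mul_div, lt_div_iff₀ (by linarith)] at hm2
      linarith
    · have h1 := (mul_le_mul_of_nonneg_right (le_max_left _ _) hr.le).trans_lt hm1
      rw [div_mul_eq_mul_div, div_lt_iff₀ (by linarith)] at h1
      linarith
  · intro α hα0 hα1 hα β hβ0 hβ1 ρ hρ
    have hq0 : 0 < α * β := mul_pos hα0 hβ0
    have hq1 : α * β < 1 := by nlinarith
    obtain ⟨N, hN⟩ := exists_forall_pow_mul_lt_one hq0 hq1 ρ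
    have hr : 0 < (α * β) ^ N * ρ := by positivity
    set r := (α * β) ^ N * ρ
    rw [lt_div_iff₀ (by positivity)] at hα
    -- The chosen scale is `b^(m+1)`, which lies in `[2αr, 2αrb)`.
    obtain ⟨m, hm1, hm2⟩ := exists_mem_Ioc_zpow (x := 2 * α * r) (by positivity) hb
    have hLb : (K * b + 2 * b) * b ^ (m + 1) ≤ (K * b + 2 * b) * (2 * α * r * b) := by
      rw [zpow_add_one₀ hb0.ne']
      gcongr
    refine schmidtWinningFrom_digitSet hb hK hd hα0 hα1 hβ0 hβ1 hρ (hN N le_rfl) (m + 1) ?_ ?_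
    · have := mul_le_mul_of_nonneg_right hα.le hr.le
      linarith
    · have h1 : 1 - 2 * β + α * β < 1 - α * β := by nlinarith
      have h2 := mul_lt_mul_of_pos_left h1 (by positivity : 0 < 2 * α * r)
      have h3 := mul_le_mul_of_nonneg_right hm2 (by linarith : 0 ≤ 1 - α * β)
      linarith
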